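/- \textbf{Setting.} A \emph{compact hybrid sequence domain} is a set $\bigcup_{j=0}^{J-1}\{k_j,\dots,k_{j+1}\}\times\{j\}\subset\mathbb{Z}_{\ge0}^2$ with $J\ge1$ and integers $0=k_0\le k_1\le\dots\le k_J$. A \emph{hybrid sequence} $\Phi$ is a map on a \emph{hybrid sequence domain} $\operatorname{dom}\Phi$, i.e. a union of a nondecreasing sequence of compact ones. It is \emph{complete} (complete in the $k$-, $j$-direction) if its domain (the set of the $k$'s, of the $j$'s occurring in its domain) is unbounded. Put $\bar\jmath_k:=\inf\{j:(k+1,j)\in\operatorname{dom}\Phi\}$ and $\bar k_j:=\inf\{k:(k,j+1)\in\operatorname{dom}\Phi\}$. Positive step sizes $\{h_k\}_{k\ge1}$ are \emph{admissible} if $h_k\to0$ and $\sum_k h_k=\infty$; a sequence $\{(h_{s,k},h_{f,k})\}_{k\ge1}$ is \emph{two-timescale admissible} if both components are admissible and $h_{s,k}/h_{f,k}\to0$. For $r\in\{s,f\}$ let $\tau_{r,k}:=\sum_{i=0}^{k-1}h_{r,i+1}$, $m_r(t):=\max\{k:\tau_{r,k}\le t\}$. Let $\mathcal H=(C,F,D,G)$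 be a hybrid inclusion ($\dot x\in F(x)$ for $x\in C$, $x^+\in G(x)$ for $x\in D$) with state $x=(x_s,x_f)\in\mathbb{R}^{n_s}\times\mathbb{R}^{n_f}$. A pair $(\Phi,\{H_k\}_{k\ge1})$, with $\Phi=(\phi_s,\phi_f)$ and $H_k=(h_{s,k},h_{f,k})$, is a \emph{two-timescale asymptotic simulation} of $\mathcal H$ if $\Phi$ is a bounded, complete hybrid sequence, $\{H_k\}$ is two-timescale admissible, and: (1) if $\Phi$ is complete in the $k$-direction, there is a bounded sequence $f_k=(f_{s,k},f_{f,k})$, $k\ge0$, such that every accumulation point of $(\Phi(k,\bar\jmath_k),f_k)_{k}$ lies in $\{(x,v):x\in C,\,v\in F(x)\}$ and, with $\hat f_{r,k+1}:=\big(\phi_r(k+1,\bar\jmath_k)-\phi_r(k,\bar\jmath_k)\big)/h_{r,k+1}$, \[\lim_{\nu\to\infty}\ \sup_{\nu+1\le k\le m_r(\tau_{r,\nu}+S)}\Big|\sum_{i=\nu}^{k-1}h_{r,i+1}\big(\hat f_{r,i+1}-f_{r,i}\big)\Big|=0\qquad\text{for all }S>0,\ r\in\{s,f\};\] (2) if $\Phi$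 is complete in the $j$-direction, every accumulation point of $(\Phi(\bar k_j,j),\Phi(\bar k_j,j+1))_j$ lies in $\{(x,v):x\in D,\,v\in G(x)\}$. \textbf{Assumptions.} (A1) $N\ge1$, $\Psi=\frac1N\sum_{i=1}^N\Psi_i$ with $\Psi_i:\mathbb{R}^n\to\mathbb{R}$ continuously differentiable; $\Psi$ has compact sublevel sets, $\nabla\Psi$ is globally Lipschitz, and the set of global minimizers of $\Psi$ equals $\{q:\nabla\Psi(q)=0\}$. (A2) $\{H_k\}_{k\ge1}$ is two-timescale admissible and $\sum_{k\ge1}h_{f,k}^{1+p}<\infty$ for some $p\in[1,\infty)$. \textbf{Simulator.} Fix $\kappa,T>0$. The state is $(\chi,\xi)$ with slow part $\chi=(q,p,\tau)\in\mathbb{R}^{n}\times\mathbb{R}^{n}\times\mathbb{R}$ and fast part $\xi\in\mathbb{R}^n$. Let $F_{\mathrm{HB}}(\chi,\xi):=(p,\,-\kappa p-\xi,\,\min\{1,2-\tau/T\})$, $G_{\mathrm{HB}}(\chi):=(q,0,0)$, \[C:=\{\langle\xi,p\rangle\le0,\ \tau\ge T\}\cup\{\tau\le T\},\qquad D:=\{\langle\xi,p\rangle\ge0,\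 \tau\ge T\}.\] Let $\{\mathbf y_k\}_{k\ge1}$ be i.i.d. uniform on $\{1,\dots,N\}$ on a probability space $(\Omega,\mathcal F,\mathbb P)$ and $\mathcal F_k:=\sigma(\mathbf y_1,\dots,\mathbf y_k)$, with $\mathcal F_0$ trivial. A \emph{solution} of the simulator is a family $\mathbf X(\omega)=(\mathbf x_s(\omega),\mathbf x_f(\omega))$, $\omega\in\Omega$, of complete hybrid sequences such that: for every $k$ the set-valued map $\omega\mapsto\{(k,j,\mathbf X(\omega)(k,j)):(k,j)\in\operatorname{dom}\mathbf X(\omega)\}$ is $\mathcal F_k$-measurable (adaptedness); if $(k,j),(k+1,j)\in\operatorname{dom}\mathbf X(\omega)$, then $\mathbf X(k,j)\in C$ and \[\frac{\mathbf x_s(k+1,j)-\mathbf x_s(k,j)}{h_{s,k+1}}=F_{\mathrm{HB}}(\mathbf x_s(k,j),\mathbf x_f(k,j)),\qquad\frac{\mathbf x_f(k+1,j)-\mathbf x_f(k,j)}{h_{f,k+1}}=\nabla\Psi_{\mathbf y_{k+1}}(\mathbf q(k,j))-\mathbf x_f(k,j),\] where $\mathbf q$ denotes the $q$-component of $\mathbf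 x_s$; if $(k,j),(k,j+1)\in\operatorname{dom}\mathbf X(\omega)$, then $\mathbf X(k,j)\in D$, $\mathbf x_s(k,j+1)=G_{\mathrm{HB}}(\mathbf x_s(k,j))$ and $\mathbf x_f(k,j+1)=\mathbf x_f(k,j)$. Let $\mathcal H_{\mathrm{2HB}}^1$ be the hybrid inclusion with flow $\dot\chi=F_{\mathrm{HB}}(\chi,\xi)$, $\dot\xi=-\xi+\nabla\Psi(q)$ on $C$ and jumps $(\chi^+,\xi^+)=(G_{\mathrm{HB}}(\chi),\xi)$ on $D$. \textbf{Lemma.} Assume (A1) and (A2), let $\mathbf X$ be a solution of the simulator, and let $\widehat\Omega\subset\Omega$ be such that $\mathbf X(\omega)$ is bounded and complete for almost every $\omega\in\widehat\Omega$. Then, for almost every $\omega\in\widehat\Omega$, the pair $(\mathbf X(\omega),\{H_k\}_{k\ge1})$ is a two-timescale asymptotic simulation of $\mathcal H_{\mathrm{2HB}}^1$. -/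

import Mathlib

open Filter Topology MeasureTheory ProbabilityTheory
open scoped ENNReal NNReal Pointwise

noncomputable section

namespace TTSA

/-! ### Hybrid sequences -/

/-- `E = ⋃_{j=0}^{J-1} {k_j, …, k_{j+1}} × {j}` with `J ≥ 1` and `0 = k_0 ≤ k_1 ≤ ⋯ ≤ k_J`. -/
def IsCompactHybridSequenceDomain (E : Set (ℕ × ℕ)) : Prop :=
  ∃ (J : ℕ) (k : ℕ → ℕ), 1 ≤ J ∧ k 0 = 0 ∧ (∀ j < J, k j ≤ k (j + 1)) ∧
    E = ⋃ j ∈ Set.Iio J, Set.Icc (k j) (k (j + 1)) ×ˢ {j}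

/-- The union of a nondecreasing sequence of compact hybrid sequence domains. -/
def IsHybridSequenceDomain (E : Set (ℕ × ℕ)) : Prop :=
  ∃ K : ℕ → Set (ℕ × ℕ), Monotone K ∧ (∀ i, IsCompactHybridSequenceDomain (K i)) ∧
    E = ⋃ i, K i

/-- A hybrid sequence with values in `X`. Only the values of `val` on `dom` are meaningful. -/
structure HybridSequence (X : Type*) where
  dom : Set (ℕ × ℕ)
  isHybridSequenceDomain : IsHybridSequenceDomain dom
  val : ℕ → ℕ → X

namespace HybridSequence

variable {X : Type*} (φ : HybridSequence X)

/-- The graph of a hybrid sequence, as a set of triples `(k, j, φ(k,j))` with `(k,j) ∈ dom φ`. -/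
def graph : Set (ℕ × ℕ × X) :=
  {z | (z.1, z.2.1) ∈ φ.dom ∧ z.2.2 = φ.val z.1 z.2.1}

/-- The domain is unbounded. -/
def Complete : Prop := ¬ BddAbove φ.dom

def CompleteK : Prop := ¬ BddAbove (Prod.fst '' φ.dom)

def CompleteJ : Prop := ¬ BddAbove (Prod.snd '' φ.dom)

def Bounded [Bornology X] : Prop :=
  Bornology.IsBounded {x | ∃ k j, (k, j) ∈ φ.dom ∧ x = φ.val k j}

/-- `inf {j : (k+1,j) ∈ dom φ}`; it is used only for `φ` complete in the `k`-direction, when the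
set is nonempty. -/
def jbar (k : ℕ) : ℕ := sInf {j | (k + 1, j) ∈ φ.dom}

/-- `inf {k : (k,j+1) ∈ dom φ}`; it is used only for `φ` complete in the `j`-direction, when the
set is nonempty. -/
def kbar (j : ℕ) : ℕ := sInf {k | (k, j + 1) ∈ φ.dom}

end HybridSequence

/-! ### Hybrid inclusions and two-timescale systems -/

/-- The data `(C, F, D, G)` of a hybrid inclusion. -/
structure HybridInclusion (X : Type*) where
  C : Set X
  F : X → Set X
  D : Set X
  G : X → Set X

namespace HybridInclusion

variable {X : Type*} (H : HybridInclusion X)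

/-- The graph of `F_C`, i.e. `graph F ∩ (C × X)`. -/
def graphFC : Set (X × X) := {z | z.1 ∈ H.C ∧ z.2 ∈ H.F z.1}

/-- The graph of `G_D`, i.e. `graph G ∩ (D × X)`. -/
def graphGD : Set (X × X) := {z | z.1 ∈ H.D ∧ z.2 ∈ H.G z.1}

end HybridInclusion

/-- The two-timescale system with flow map `F^ε(x) = F_s(x) × ε⁻¹ F_f(x)`. -/
def twoTimescaleSystem {Xs Xf : Type*} [SMul ℝ Xf] (C : Set (Xs × Xf))
    (Fs : Xs × Xf → Set Xs) (Ff : Xs × Xf → Set Xf) (D : Set (Xs × Xf))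
    (G : Xs × Xf → Set (Xs × Xf)) (ε : ℝ) : HybridInclusion (Xs × Xf) where
  C := C
  F := fun x => Fs x ×ˢ (ε⁻¹ • Ff x)
  D := D
  G := G

/-! ### Step sizes. Sequences of step sizes are indexed from `1`; `h 0` is never used. -/

structure Admissible (h : ℕ → ℝ) : Prop where
  pos : ∀ k, 1 ≤ k → 0 < h k
  tendsto_zero : Tendsto h atTop (𝓝 0)
  not_summable : ¬ Summable (fun k => h (k + 1))

/-- The accumulated time `τ_k = ∑_{i=0}^{k-1} h_{i+1}`. -/
def accTime (h : ℕ → ℝ) (k : ℕ) : ℝ := ∑ i ∈ Finset.range k, h (i + 1)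

/-- `m(t) = max {k : τ_k ≤ t}` (for admissible `h` and `t ≥ 0` the set is nonempty and finite). -/
def maxIndex (h : ℕ → ℝ) (t : ℝ) : ℕ := sSup {k | accTime h k ≤ t}

/-- The index set `{k : n + 1 ≤ k ≤ m(τ_n + T)}`. -/
def indexSet (h : ℕ → ℝ) (n : ℕ) (T : ℝ) : Set ℕ :=
  Set.Icc (n + 1) (maxIndex h (accTime h n + T))

structure TwoTimescaleAdmissible (hs hf : ℕ → ℝ) : Prop where
  slow : Admissible hs
  fast : Admissible hf
  separation : Tendsto (fun k => hs k / hf k) atTop (𝓝 0)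

/-! ### Two-timescale asymptotic simulations -/

/-- The outer limit of a sequence of points: the set of its accumulation points. -/
def outerLimit {X : Type*} [TopologicalSpace X] (u : ℕ → X) : Set X :=
  {z | MapClusterPt z atTop u}

/-- For each `T > 0`,
`lim_{n → ∞} sup_{n+1 ≤ k ≤ m(τ_n+T)} |∑_{i=n}^{k-1} h_{i+1} (fhat_{i+1} - f_i)| = 0`. -/
def AsymptoticallyClose {X : Type*} [NormedAddCommGroup X] [NormedSpace ℝ X]
    (h : ℕ → ℝ) (fhat f : ℕ → X) : Prop :=
  ∀ T : ℝ, 0 < T →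
    Tendsto (fun n : ℕ =>
      sSup ((fun k : ℕ => ‖∑ i ∈ Finset.Ico n k, h (i + 1) • (fhat (i + 1) - f i)‖) ''
        indexSet h n T)) atTop (𝓝 0)

/-- The increment quotient `(φ(k, jbar_{k-1}) - φ(k-1, jbar_{k-1})) / h_k` for `k ≥ 1`, where
`φ = π ∘ Φ` is a component of the hybrid sequence `Φ`. -/
def incrementQuotient {X Y : Type*} [AddCommGroup Y] [Module ℝ Y] (Φ : HybridSequence X)
    (π : X → Y) (h : ℕ → ℝ) (k : ℕ) : Y :=
  (h k)⁻¹ • (π (Φ.val k (Φ.jbar (k - 1))) - π (Φ.val (k - 1) (Φ.jbar (k - 1))))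

/-- `(Φ, (hs, hf))` is a two-timescale asymptotic simulation of the hybrid inclusion `H`, whose
state space is the product of the slow and the fast state spaces. -/
structure IsTwoTimescaleAsymptoticSimulation {Xs Xf : Type*}
    [NormedAddCommGroup Xs] [NormedSpace ℝ Xs] [NormedAddCommGroup Xf] [NormedSpace ℝ Xf]
    (H : HybridInclusion (Xs × Xf)) (Φ : HybridSequence (Xs × Xf)) (hs hf : ℕ → ℝ) : Prop where
  bounded : Φ.Bounded
  complete : Φ.Complete
  admissible : TwoTimescaleAdmissible hs hf
  flow : Φ.CompleteK → ∃ f : ℕ → Xs × Xf,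
    Bornology.IsBounded (Set.range f) ∧
    outerLimit (fun k => (Φ.val k (Φ.jbar k), f k)) ⊆ H.graphFC ∧
    AsymptoticallyClose hs (incrementQuotient Φ Prod.fst hs) (fun k => (f k).1) ∧
    AsymptoticallyClose hf (incrementQuotient Φ Prod.snd hf) (fun k => (f k).2)
  jump : Φ.CompleteJ →
    outerLimit (fun j => (Φ.val (Φ.kbar j) j, Φ.val (Φ.kbar j) (j + 1))) ⊆ H.graphGD

/-! ### The hybrid heavy ball system -/

abbrev Vec (n : ℕ) : Type := EuclideanSpace ℝ (Fin n)

/-- The slow state `χ = (q, p, τ)`. -/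
abbrev Slow (n : ℕ) : Type := Vec n × Vec n × ℝ

/-- The overall state `(χ, ξ)`. -/
abbrev State (n : ℕ) : Type := Slow n × Vec n

/-- `F_HB(χ, g) = (p, -κ p - g, min {1, 2 - τ/T})`. -/
def flowHB {n : ℕ} (κ T : ℝ) (χ : Slow n) (g : Vec n) : Slow n :=
  (χ.2.1, -(κ • χ.2.1) - g, min 1 (2 - χ.2.2 / T))

/-- `G_HB(χ) = (q, 0, 0)`. -/
def jumpHB {n : ℕ} (χ : Slow n) : Slow n := (χ.1, 0, 0)

/-- The flow set `{⟨ξ, p⟩ ≤ 0, τ ≥ T} ∪ {τ ≤ T}`. -/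
def flowSet (n : ℕ) (T : ℝ) : Set (State n) :=
  {x | inner ℝ x.2 x.1.2.1 ≤ 0 ∧ T ≤ x.1.2.2} ∪ {x | x.1.2.2 ≤ T}

/-- The jump set `{⟨ξ, p⟩ ≥ 0, τ ≥ T}`. -/
def jumpSet (n : ℕ) (T : ℝ) : Set (State n) :=
  {x | 0 ≤ inner ℝ x.2 x.1.2.1 ∧ T ≤ x.1.2.2}

/-- The system with `χ' = F_HB(χ, ξ)`, `ε ξ' = -ξ + ∇Ψ(q)` on the flow set, and
`(χ⁺, ξ⁺) = (G_HB(χ), ξ)` on the jump set. -/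
def system2HB {n : ℕ} (Ψ : Vec n → ℝ) (κ T ε : ℝ) : HybridInclusion (State n) :=
  twoTimescaleSystem (flowSet n T)
    (fun x => {flowHB κ T x.1 x.2})
    (fun x => {-x.2 + gradient Ψ x.1.1})
    (jumpSet n T)
    (fun x => {(jumpHB x.1, x.2)})
    ε

/-- The standing assumption on the objective `Ψ` and its summands `Ψi`. -/
structure ObjectiveAssumption {n N : ℕ} (Ψ : Vec n → ℝ) (Ψi : Fin N → Vec n → ℝ) : Prop where
  contDiff : ContDiff ℝ 1 Ψ
  compact_sublevel : ∀ c : ℝ, IsCompact {q | Ψ q ≤ c}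
  lipschitz_gradient : ∃ L : ℝ≥0, LipschitzWith L (gradient Ψ)
  minimizers_eq_critical : {q | ∀ q', Ψ q ≤ Ψ q'} = {q | gradient Ψ q = 0}
  one_le : 1 ≤ N
  summand_contDiff : ∀ i, ContDiff ℝ 1 (Ψi i)
  finite_sum : ∀ q, Ψ q = (1 / (N : ℝ)) * ∑ i, Ψi i q

/-- The standing assumption on the step sizes. -/
structure StepAssumption (hs hf : ℕ → ℝ) : Prop where
  admissible : TwoTimescaleAdmissible hs hf
  summable : ∃ p : ℝ, 1 ≤ p ∧ Summable (fun k : ℕ => hf (k + 1) ^ (1 + p))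

/-! ### The stochastic simulator -/

section Stochastic

variable {Ω : Type*} [MeasurableSpace Ω] {n N : ℕ}

/-- `y_1, y_2, …` are independent and uniformly distributed on the `N` indices (`y 0` is never
used). -/
structure IsUniformIID (P : Measure Ω) (y : ℕ → Ω → Fin N) : Prop where
  measurable : ∀ k, 1 ≤ k → Measurable (y k)
  uniform : ∀ k, 1 ≤ k → ∀ i, P (y k ⁻¹' {i}) = (N : ℝ≥0∞)⁻¹
  indep : iIndepFun (fun k => y (k + 1)) P

/-- The minimal filtration `ℱ_k = σ(y_1, …, y_k)`; in particular `ℱ_0` is trivial. -/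
def noiseFiltration {Ω : Type*} {N : ℕ} (y : ℕ → Ω → Fin N) (k : ℕ) : MeasurableSpace Ω :=
  ⨆ i ∈ Set.Icc 1 k, MeasurableSpace.comap (y i) inferInstance

/-- Measurability of a set-valued mapping with respect to the σ-algebra `m`: the preimage
`{ω : S(ω) ∩ U ≠ ∅}` of each open set `U` belongs to `m`. -/
def SetValuedMeasurable {Ω Z : Type*} [TopologicalSpace Z] (m : MeasurableSpace Ω)
    (S : Ω → Set Z) : Prop :=
  ∀ U : Set Z, IsOpen U → MeasurableSet[m] {ω | (S ω ∩ U).Nonempty}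

/-- For each `k`, the mapping `ω ↦ graph (X ω) ∩ ({k} × ⋯)` is `ℱ_k`-measurable. -/
def Adapted {Ω Z : Type*} [TopologicalSpace Z] {N : ℕ} (y : ℕ → Ω → Fin N)
    (X : Ω → HybridSequence Z) : Prop :=
  ∀ k : ℕ, SetValuedMeasurable (noiseFiltration y k)
    (fun ω => (X ω).graph ∩ {z | z.1 = k})

/-- A sample path satisfies the constraints of the simulator for the realization `y` of the
noise. -/
structure SatisfiesSimulator (Ψi : Fin N → Vec n → ℝ) (κ T : ℝ) (hs hf : ℕ → ℝ)
    (y : ℕ → Fin N) (x : HybridSequence (State n)) : Prop where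
  flow : ∀ k j, (k, j) ∈ x.dom → (k + 1, j) ∈ x.dom →
    x.val k j ∈ flowSet n T ∧
    (hs (k + 1))⁻¹ • ((x.val (k + 1) j).1 - (x.val k j).1)
      = flowHB κ T (x.val k j).1 (x.val k j).2 ∧
    (hf (k + 1))⁻¹ • ((x.val (k + 1) j).2 - (x.val k j).2)
      = gradient (Ψi (y (k + 1))) (x.val k j).1.1 - (x.val k j).2
  jump : ∀ k j, (k, j) ∈ x.dom → (k, j + 1) ∈ x.dom →
    x.val k j ∈ jumpSet n T ∧
    (x.val k (j + 1)).1 = jumpHB (x.val k j).1 ∧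
    (x.val k (j + 1)).2 = (x.val k j).2

/-- `X` is a solution of the stochastic simulator driven by the noise `y`. -/
structure IsSimulatorSolution {Ω : Type*} (Ψi : Fin N → Vec n → ℝ) (κ T : ℝ) (hs hf : ℕ → ℝ)
    (y : ℕ → Ω → Fin N) (X : Ω → HybridSequence (State n)) : Prop where
  adapted : Adapted y X
  complete : ∀ ω, (X ω).Complete
  satisfies : ∀ ω, SatisfiesSimulator Ψi κ T hs hf (fun k => y k ω) (X ω)

end Stochastic

end TTSA

end

noncomputable section

namespace TTSA

/-! ### Hybrid sequence domains -/

/-! Take `f k` to be the limiting flow map at `Φ(k, jbar k)`. The simulator then meets the flow and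
jump inclusions exactly, except that the fast increment uses a sampled gradient. The graphs over `C`
and `D` are closed, so they contain all accumulation points, and the slow error is zero. What
remains is the weighted sum of the gradient errors.

Jumps fix `q`, so `q` depends on `k` only and is `ℱ_k`-measurable; the errors are martingale
differences. Paths are bounded only individually, so errors are truncated to `‖q‖ ≤ R`, and
countably many `R` cover all bounded paths.

Hoeffding's lemma, iterated along the filtration and combined with stopping, bounds the probability
that a partial sum over a window reaches `ε` by `exp(-ε² / (2B²V))`, where `V` is the sum of squared
steps (`IsNoiseDifference.measure_exists_le`). This is at most `C V^p`, and Hölder bounds `V^p` by a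
constant times the window sum of `h^(1+p)`. Summability and Borel–Cantelli control the windows from
`l * S` to `(l + 2) * S`, which capture every window in the definition
(`Admissible.asymptoticallyClose`). -/

lemma IsCompactHybridSequenceDomain.mem_of_mem_of_mem {E : Set (ℕ × ℕ)}
    (hE : IsCompactHybridSequenceDomain E) {k j i j' : ℕ} (hj : (k, j) ∈ E) (hj' : (k, j') ∈ E)
    (hji : j ≤ i) (hij : i ≤ j') : (k, i) ∈ E := by
  obtain ⟨J, κ, -, -, hκ, rfl⟩ := hE
  simp only [Set.mem_iUnion, Set.mem_Iio, Set.mem_prod, Set.mem_Icc, Set.mem_singleton_iff,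
    exists_prop] at hj hj' ⊢
  obtain ⟨_, hJ, ⟨h1, h2⟩, rfl⟩ := hj
  obtain ⟨_, hJ', ⟨h3, h4⟩, rfl⟩ := hj'
  have mono : ∀ a b, a ≤ b → b ≤ J → κ a ≤ κ b := by
    intro a b hab
    induction b, hab using Nat.le_induction with
    | base => intro _; exact le_rfl
    | succ b _ ih => intro hb; exact (ih (by omega)).trans (hκ b (by omega))
  exact ⟨i, by omega, ⟨(mono i j' hij (by omega)).trans h3,
    h2.trans (mono (j + 1) (i + 1) (by omega) (by omega))⟩, rfl⟩

/-- The left end of a row is the right end of the previous one, and row `0` starts at `0`. For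
minimal `j` the second alternative is impossible, which puts `(k, jbar k)` in the domain. -/
lemma IsCompactHybridSequenceDomain.mem_or_mem_of_succ_mem {E : Set (ℕ × ℕ)}
    (hE : IsCompactHybridSequenceDomain E) {k j : ℕ} (h : (k + 1, j) ∈ E) :
    (k, j) ∈ E ∨ ∃ i < j, (k + 1, i) ∈ E := by
  obtain ⟨J, κ, -, h0, hκ, rfl⟩ := hE
  simp only [Set.mem_iUnion, Set.mem_Iio, Set.mem_prod, Set.mem_Icc, Set.mem_singleton_iff,
    exists_prop] at h ⊢
  obtain ⟨_, hJ, ⟨h1, h2⟩, rfl⟩ := h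
  by_cases hk : κ j ≤ k
  · exact Or.inl ⟨j, hJ, ⟨hk, by omega⟩, rfl⟩
  · right
    obtain _ | j := j
    · omega
    · exact ⟨j, by omega, j, by omega, ⟨(hκ j (by omega)).trans h1, by omega⟩, rfl⟩

lemma IsCompactHybridSequenceDomain.mem_or_mem_of_mem_succ {E : Set (ℕ × ℕ)}
    (hE : IsCompactHybridSequenceDomain E) {k j : ℕ} (h : (k, j + 1) ∈ E) :
    (k, j) ∈ E ∨ ∃ i < k, (i, j + 1) ∈ E := by
  obtain ⟨J, κ, -, h0, hκ, rfl⟩ := hE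
  simp only [Set.mem_iUnion, Set.mem_Iio, Set.mem_prod, Set.mem_Icc, Set.mem_singleton_iff,
    exists_prop] at h ⊢
  obtain ⟨_, hJ, ⟨h1, h2⟩, rfl⟩ := h
  rcases h1.eq_or_lt with hk | hk
  · exact Or.inl ⟨j, by omega, ⟨(hκ j (by omega)).trans h1, by omega⟩, rfl⟩
  · exact Or.inr ⟨κ (j + 1), hk, j + 1, hJ, ⟨le_rfl, hκ _ hJ⟩, rfl⟩

namespace HybridSequence

variable {X : Type*} (φ : HybridSequence X)

lemma mem_dom_of_mem_of_mem {k j i j' : ℕ} (hj : (k, j) ∈ φ.dom) (hj' : (k, j') ∈ φ.dom)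
    (hji : j ≤ i) (hij : i ≤ j') : (k, i) ∈ φ.dom := by
  obtain ⟨K, hK, hc, h⟩ := φ.isHybridSequenceDomain
  rw [h, Set.mem_iUnion] at hj hj' ⊢
  obtain ⟨a, ha⟩ := hj
  obtain ⟨b, hb⟩ := hj'
  exact ⟨max a b, (hc _).mem_of_mem_of_mem (hK (le_max_left a b) ha) (hK (le_max_right a b) hb)
    hji hij⟩

lemma mem_dom_or_of_succ_mem {k j : ℕ} (h : (k + 1, j) ∈ φ.dom) :
    (k, j) ∈ φ.dom ∨ ∃ i < j, (k + 1, i) ∈ φ.dom := by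
  obtain ⟨K, -, hc, hd⟩ := φ.isHybridSequenceDomain
  simp only [hd, Set.mem_iUnion] at h ⊢
  obtain ⟨a, ha⟩ := h
  rcases (hc a).mem_or_mem_of_succ_mem ha with h | ⟨i, hi, h⟩
  · exact Or.inl ⟨a, h⟩
  · exact Or.inr ⟨i, hi, a, h⟩

lemma mem_dom_or_of_mem_succ {k j : ℕ} (h : (k, j + 1) ∈ φ.dom) :
    (k, j) ∈ φ.dom ∨ ∃ i < k, (i, j + 1) ∈ φ.dom := by
  obtain ⟨K, -, hc, hd⟩ := φ.isHybridSequenceDomain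
  simp only [hd, Set.mem_iUnion] at h ⊢
  obtain ⟨a, ha⟩ := h
  rcases (hc a).mem_or_mem_of_mem_succ ha with h | ⟨i, hi, h⟩
  · exact Or.inl ⟨a, h⟩
  · exact Or.inr ⟨i, hi, a, h⟩

lemma mem_dom_sInf_fst {k : ℕ} (h : ∃ j, (k + 1, j) ∈ φ.dom) :
    (k + 1, φ.jbar k) ∈ φ.dom ∧ (k, φ.jbar k) ∈ φ.dom := by
  have hmem : (k + 1, φ.jbar k) ∈ φ.dom := Nat.sInf_mem (s := {j | (k + 1, j) ∈ φ.dom}) h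
  refine ⟨hmem, (φ.mem_dom_or_of_succ_mem hmem).resolve_right ?_⟩
  rintro ⟨i, hi, h⟩
  exact Nat.notMem_of_lt_sInf hi h

lemma mem_dom_sInf_snd {j : ℕ} (h : ∃ k, (k, j + 1) ∈ φ.dom) :
    (φ.kbar j, j + 1) ∈ φ.dom ∧ (φ.kbar j, j) ∈ φ.dom := by
  have hmem : (φ.kbar j, j + 1) ∈ φ.dom := Nat.sInf_mem (s := {k | (k, j + 1) ∈ φ.dom}) h
  refine ⟨hmem, (φ.mem_dom_or_of_mem_succ hmem).resolve_right ?_⟩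
  rintro ⟨i, hi, h⟩
  exact Nat.notMem_of_lt_sInf hi h

variable {φ}

/-- Unboundedness supplies an index beyond `k`; stepping left through `(k, jbar k)` then descends to
`k` itself. -/
lemma CompleteK.exists_mem (h : φ.CompleteK) (k : ℕ) : ∃ j, (k, j) ∈ φ.dom := by
  obtain ⟨_, ⟨⟨a, b⟩, hab, rfl⟩, hk⟩ := not_bddAbove_iff.1 h k
  have key : ∀ m, (∃ j, (k + m, j) ∈ φ.dom) → ∃ j, (k, j) ∈ φ.dom := by
    intro m
    induction m with
    | zero => exact id
    | succ m ih => intro h; exact ih ⟨_, (φ.mem_dom_sInf_fst h).2⟩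
  exact key (a - k) ⟨b, by rwa [Nat.add_sub_cancel' hk.le]⟩

lemma CompleteJ.exists_mem (h : φ.CompleteJ) (j : ℕ) : ∃ k, (k, j) ∈ φ.dom := by
  obtain ⟨_, ⟨⟨a, b⟩, hab, rfl⟩, hk⟩ := not_bddAbove_iff.1 h j
  have key : ∀ m, (∃ k, (k, j + m) ∈ φ.dom) → ∃ k, (k, j) ∈ φ.dom := by
    intro m
    induction m with
    | zero => exact id
    | succ m ih => intro h; exact ih ⟨_, (φ.mem_dom_sInf_snd h).2⟩
  exact key (b - j) ⟨a, by rwa [Nat.add_sub_cancel' hk.le]⟩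

end HybridSequence

lemma outerLimit_subset_of_isClosed {X : Type*} [TopologicalSpace X] {u : ℕ → X} {s : Set X}
    (hs : IsClosed s) (hu : ∀ k, u k ∈ s) : outerLimit u ⊆ s := fun _ hz =>
  isClosed_iff_clusterPt.1 hs _ (ClusterPt.mono hz
    (le_principal_iff.2 (Eventually.of_forall hu : ∀ᶠ k in atTop, u k ∈ s)))

/-! ### Accumulated time -/

section Time

variable {h : ℕ → ℝ}

lemma Admissible.strictMono_accTime (hh : Admissible h) : StrictMono (accTime h) :=
  strictMono_nat_of_lt_succ fun k => by
    rw [accTime, accTime, Finset.sum_range_succ]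
    exact lt_add_of_pos_right _ (hh.pos _ (by omega))

lemma Admissible.tendsto_accTime (hh : Admissible h) : Tendsto (accTime h) atTop atTop :=
  (not_summable_iff_tendsto_nat_atTop_of_nonneg fun k => (hh.pos _ (by omega)).le).1
    hh.not_summable

lemma accTime_sub_accTime {a b : ℕ} (hab : a ≤ b) :
    accTime h b - accTime h a = ∑ i ∈ Finset.Ico a b, h (i + 1) := by
  rw [Finset.sum_Ico_eq_sub _ hab]; rfl

/-- The first index at which the accumulated time is at least `t`. -/
def hitIndex (h : ℕ → ℝ) (t : ℝ) : ℕ := sInf {k | t ≤ accTime h k}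

lemma Admissible.le_accTime_hitIndex (hh : Admissible h) (t : ℝ) :
    t ≤ accTime h (hitIndex h t) :=
  Nat.sInf_mem (s := {k | t ≤ accTime h k}) (hh.tendsto_accTime.eventually_ge_atTop t).exists

lemma Admissible.lt_hitIndex_iff (hh : Admissible h) {k : ℕ} {t : ℝ} :
    k < hitIndex h t ↔ accTime h k < t := by
  refine ⟨fun hk => not_le.1 fun h' => Nat.notMem_of_lt_sInf hk h', fun hk => ?_⟩
  exact hh.strictMono_accTime.lt_iff_lt.1 (hk.trans_le (hh.le_accTime_hitIndex t))

lemma Admissible.hitIndex_le_iff (hh : Admissible h) {k : ℕ} {t : ℝ} :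
    hitIndex h t ≤ k ↔ t ≤ accTime h k := by
  simpa using hh.lt_hitIndex_iff.not

lemma Admissible.monotone_hitIndex (hh : Admissible h) : Monotone (hitIndex h) :=
  fun _ b hab => hh.hitIndex_le_iff.2 (hab.trans (hh.le_accTime_hitIndex b))

lemma Admissible.exists_bound (hh : Admissible h) : ∃ B, 0 ≤ B ∧ ∀ k, h (k + 1) ≤ B := by
  obtain ⟨B, hB⟩ := hh.tendsto_zero.bddAbove_range
  have hB' : ∀ k, h (k + 1) ≤ B := fun k => hB ⟨k + 1, rfl⟩
  exact ⟨B, (hh.pos 1 le_rfl).le.trans (hB' 0), hB'⟩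

/-- The overshoot past `t` is at most the last step taken. -/
lemma Admissible.accTime_hitIndex_le (hh : Admissible h) {B t : ℝ} (hB : ∀ k, h (k + 1) ≤ B)
    (hB0 : 0 ≤ B) (ht : 0 ≤ t) : accTime h (hitIndex h t) ≤ t + B := by
  rcases hk : hitIndex h t with _ | k
  · simp only [accTime, Finset.range_zero, Finset.sum_empty]; positivity
  · have : accTime h k < t := hh.lt_hitIndex_iff.1 (by omega)
    rw [accTime, Finset.sum_range_succ]
    exact add_le_add this.le (hB k)

lemma Admissible.accTime_le_of_mem_indexSet (hh : Admissible h) {n k : ℕ} {S : ℝ} (hS : 0 ≤ S)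
    (hk : k ∈ indexSet h n S) : n < k ∧ accTime h k ≤ accTime h n + S := by
  refine ⟨hk.1, ?_⟩
  -- The supremum defining `maxIndex` is attained only because the set is bounded; in `ℕ` an
  -- unbounded set has `sSup` equal to `0`.
  have hbdd : BddAbove {k | accTime h k ≤ accTime h n + S} := by
    obtain ⟨m, hm⟩ := (hh.tendsto_accTime.eventually_gt_atTop (accTime h n + S)).exists
    exact ⟨m, fun i hi => (hh.strictMono_accTime.lt_iff_lt.1 (lt_of_le_of_lt hi hm)).le⟩
  have hmem : accTime h (maxIndex h (accTime h n + S)) ≤ accTime h n + S :=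
    Nat.sSup_mem (s := {k | accTime h k ≤ accTime h n + S})
      ⟨n, le_add_of_nonneg_right hS⟩ hbdd
  exact (hh.strictMono_accTime.monotone hk.2).trans hmem

/-- Asymptotic closeness follows from smallness of the partial sums on time windows of length
`2 * S` starting at the multiples of `S`. -/
lemma Admissible.asymptoticallyClose {X : Type*} [NormedAddCommGroup X] [NormedSpace ℝ X]
    (hh : Admissible h) {fhat f : ℕ → X}
    (H : ∀ S : ℕ, 0 < S → ∀ ε : ℝ, 0 < ε → ∀ᶠ l : ℕ in atTop,
      ∀ k ∈ Set.Icc (hitIndex h (l * S)) (hitIndex h ((l + 2 : ℕ) * S)),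
        ‖∑ i ∈ Finset.Ico (hitIndex h (l * S)) k, h (i + 1) • (fhat (i + 1) - f i)‖ ≤ ε) :
    AsymptoticallyClose h fhat f := by
  intro S hS
  set d : ℕ → X := fun i => h (i + 1) • (fhat (i + 1) - f i)
  -- Integer window lengths suffice, so only countably many almost sure events are needed later.
  obtain ⟨S', hS'⟩ := exists_nat_ge S
  have hS'0 : (0 : ℝ) < S' := hS.trans_le hS'
  have hl : Tendsto (fun n => ⌊accTime h n / S'⌋₊) atTop atTop :=
    tendsto_nat_floor_atTop.comp (hh.tendsto_accTime.atTop_div_const hS'0)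
  rw [Metric.tendsto_atTop']
  intro ε hε
  obtain ⟨n₀, hn₀⟩ := eventually_atTop.1
    (hl.eventually (H S' (by exact_mod_cast hS'0) (ε / 4) (by positivity)))
  refine ⟨n₀, fun n hn => ?_⟩
  specialize hn₀ n hn.le
  set l := ⌊accTime h n / S'⌋₊
  have hτ0 : 0 ≤ accTime h n := Finset.sum_nonneg fun i _ => (hh.pos _ (by omega)).le
  have h1 : (l : ℝ) * S' ≤ accTime h n :=
    (le_div_iff₀ hS'0).1 (Nat.floor_le (by positivity))
  have h2 : accTime h n < (l + 1) * S' := (div_lt_iff₀ hS'0).1 (Nat.lt_floor_add_one _)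
  have hln : hitIndex h (l * S') ≤ n := hh.hitIndex_le_iff.2 h1
  have hle : ∀ k ∈ indexSet h n S, ‖∑ i ∈ Finset.Ico n k, d i‖ ≤ ε / 2 := by
    intro k hk
    obtain ⟨hnk, hτ⟩ := hh.accTime_le_of_mem_indexSet hS.le hk
    have hkl : k < hitIndex h ((l + 2 : ℕ) * S') := hh.lt_hitIndex_iff.2 (by push_cast; linarith)
    have e1 := hn₀ k ⟨by omega, by omega⟩
    have e2 := hn₀ n ⟨hln, by omega⟩
    -- Both `n` and `k` lie in window `l`, so the sum is a difference of two sums from the window's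
    -- start.
    have : ∑ i ∈ Finset.Ico n k, d i = ∑ i ∈ Finset.Ico (hitIndex h (l * S')) k, d i
        - ∑ i ∈ Finset.Ico (hitIndex h (l * S')) n, d i := by
      rw [← Finset.sum_Ico_consecutive d hln hnk.le]; abel
    rw [this]
    calc _ ≤ _ := norm_sub_le _ _
      _ ≤ ε / 4 + ε / 4 := add_le_add e1 e2
      _ = ε / 2 := by ring
  rw [Real.dist_0_eq_abs, abs_of_nonneg]
  · refine (Real.sSup_le ?_ (by positivity)).trans_lt (half_lt_self hε)
    rintro _ ⟨k, hk, rfl⟩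
    exact hle k hk
  · refine Real.sSup_nonneg ?_
    rintro _ ⟨k, hk, rfl⟩
    exact norm_nonneg _

/-- Hölder's inequality for the function `h` with weights `h`, raised to the power `p`. -/
lemma sum_Ico_sq_rpow_le {h : ℕ → ℝ} (hpos : ∀ k, 0 < h (k + 1)) {p : ℝ} (hp : 1 ≤ p) (a b : ℕ) :
    (∑ i ∈ Finset.Ico a b, h (i + 1) ^ 2) ^ p ≤
      (∑ i ∈ Finset.Ico a b, h (i + 1)) ^ (p - 1) *
        ∑ i ∈ Finset.Ico a b, h (i + 1) ^ (1 + p) := by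
  have hp0 : 0 < p := by linarith
  have key := Real.inner_le_weight_mul_Lp_of_nonneg (Finset.Ico a b) hp (fun i => h (i + 1))
    (fun i => h (i + 1)) (fun i => (hpos i).le) (fun i => (hpos i).le)
  have hA : 0 ≤ ∑ i ∈ Finset.Ico a b, h (i + 1) := Finset.sum_nonneg fun i _ => (hpos i).le
  have hB : ∑ i ∈ Finset.Ico a b, h (i + 1) * h (i + 1) ^ p
      = ∑ i ∈ Finset.Ico a b, h (i + 1) ^ (1 + p) :=
    Finset.sum_congr rfl fun i _ => by rw [Real.rpow_add (hpos i), Real.rpow_one]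
  have hB0 : 0 ≤ ∑ i ∈ Finset.Ico a b, h (i + 1) ^ (1 + p) :=
    Finset.sum_nonneg fun i _ => Real.rpow_nonneg (hpos i).le _
  rw [hB] at key
  simp only [← sq] at key
  calc _ ≤ _ := Real.rpow_le_rpow (Finset.sum_nonneg fun i _ => sq_nonneg _) key hp0.le
    _ = _ := by
      rw [Real.mul_rpow (Real.rpow_nonneg hA _) (Real.rpow_nonneg hB0 _), ← Real.rpow_mul hA,
        ← Real.rpow_mul hB0, inv_mul_cancel₀ hp0.ne', Real.rpow_one]
      congr 2
      field_simp

lemma summable_sum_Ico {g : ℕ → ℝ} (hg : ∀ i, 0 ≤ g i) (hs : Summable g) {b : ℕ → ℕ}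
    (hb : Monotone b) : Summable fun l => ∑ i ∈ Finset.Ico (b l) (b (l + 1)), g i := by
  refine summable_of_sum_range_le (c := ∑' i, g i)
    (fun l => Finset.sum_nonneg fun i _ => hg i) fun L => ?_
  have : ∑ l ∈ Finset.range L, ∑ i ∈ Finset.Ico (b l) (b (l + 1)), g i
      = ∑ i ∈ Finset.Ico (b 0) (b L), g i := by
    induction L with
    | zero => simp
    | succ L ih =>
      rw [Finset.sum_range_succ, ih,
        Finset.sum_Ico_consecutive _ (hb (Nat.zero_le _)) (hb (Nat.le_succ _))]
  rw [this]
  exact hs.sum_le_tsum _ fun i _ => hg i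

/-- Each window consists of two consecutive blocks and has accumulated length at most `2 * S + B`,
so the Hölder bound reduces the claim to block sums of `h^(1+p)`. -/
lemma Admissible.summable_sum_sq_rpow (hh : Admissible h) {p : ℝ} (hp : 1 ≤ p)
    (hs : Summable fun k : ℕ => h (k + 1) ^ (1 + p)) (S : ℕ) :
    Summable fun l : ℕ => (∑ i ∈ Finset.Ico (hitIndex h (l * S)) (hitIndex h ((l + 2 : ℕ) * S)),
      h (i + 1) ^ 2) ^ p := by
  have hpos : ∀ k, 0 < h (k + 1) := fun k => hh.pos _ (by omega)
  set b : ℕ → ℕ := fun l => hitIndex h (l * S)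
  have hb : Monotone b := fun l l' hl => hh.monotone_hitIndex (by gcongr)
  obtain ⟨B, hB0, hB⟩ := hh.exists_bound
  have hg : ∀ i, 0 ≤ h (i + 1) ^ (1 + p) := fun i => Real.rpow_nonneg (hpos i).le _
  have h1 := summable_sum_Ico hg hs hb
  have h2 := (summable_nat_add_iff 1).2 h1
  refine Summable.of_nonneg_of_le
    (fun l => Real.rpow_nonneg (Finset.sum_nonneg fun i _ => sq_nonneg _) _) (fun l => ?_)
    ((h1.add h2).mul_left ((2 * S + B) ^ (p - 1)))
  refine (sum_Ico_sq_rpow_le hpos hp _ _).trans ?_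
  rw [Finset.sum_Ico_consecutive _ (hb (Nat.le_succ l)) (hb (Nat.le_succ _))]
  refine mul_le_mul_of_nonneg_right ?_ (Finset.sum_nonneg fun i _ => hg i)
  refine Real.rpow_le_rpow (Finset.sum_nonneg fun i _ => (hpos i).le) ?_ (by linarith)
  rw [← accTime_sub_accTime (hb (by omega : l ≤ l + 2))]
  have e1 := hh.accTime_hitIndex_le hB hB0 (t := ((l + 2 : ℕ) : ℝ) * S) (by positivity)
  have e2 := hh.le_accTime_hitIndex ((l : ℝ) * S)
  change accTime h (hitIndex h ((l + 2 : ℕ) * S)) - accTime h (hitIndex h (l * S)) ≤ 2 * S + B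
  push_cast at e1 ⊢
  linarith

end Time

/-! ### Exponential bounds for martingale differences driven by uniform noise -/

/-- By convexity `exp` lies below its chord over `[-b, b]`. The chord's linear part vanishes when
averaged over centred values. -/
lemma exp_le_cosh_add_mul {b x : ℝ} (hb : 0 < b) (hx : |x| ≤ b) :
    Real.exp x ≤ Real.cosh b + x * (Real.sinh b / b) := by
  obtain ⟨h1, h2⟩ := abs_le.1 hx
  have := convexOn_exp.2 (Set.mem_univ b) (Set.mem_univ (-b))
    (div_nonneg (by linarith) (by linarith) : 0 ≤ (b + x) / (2 * b))
    (div_nonneg (by linarith) (by linarith) : 0 ≤ (b - x) / (2 * b)) (by field_simp; ring)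
  simp only [smul_eq_mul] at this
  have e : (b + x) / (2 * b) * b + (b - x) / (2 * b) * -b = x := by field_simp; ring
  rw [e] at this
  refine this.trans (le_of_eq ?_)
  rw [Real.cosh_eq, Real.sinh_eq]
  field_simp
  ring

/-- Hoeffding's lemma for the uniform distribution on a finite type. -/
lemma sum_exp_le_card_mul_exp {ι : Type*} [Fintype ι] {x : ι → ℝ} {b : ℝ}
    (hx : ∀ c, |x c| ≤ b) (h0 : ∑ c, x c = 0) :
    ∑ c, Real.exp (x c) ≤ Fintype.card ι * Real.exp (b ^ 2 / 2) := by
  rcases le_or_gt b 0 with hb | hb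
  · calc ∑ c, Real.exp (x c) ≤ ∑ _c : ι, Real.exp (b ^ 2 / 2) := by
          refine Finset.sum_le_sum fun c _ => Real.exp_le_exp.2 ?_
          exact (le_abs_self _).trans (((hx c).trans hb).trans (by positivity))
      _ = _ := by simp
  · calc ∑ c, Real.exp (x c) ≤ ∑ c, (Real.cosh b + x c * (Real.sinh b / b)) :=
          Finset.sum_le_sum fun c _ => exp_le_cosh_add_mul hb (hx c)
      _ = Fintype.card ι * Real.cosh b := by
          rw [Finset.sum_add_distrib, ← Finset.sum_mul, h0]; simp
      _ ≤ _ := by gcongr; exact Real.cosh_le_exp_half_sq b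

/-- Raise `x ≤ exp x` at `x = a / (V p)` to the power `p`. This trades the exponential tail for a
power of `V` that is summable over windows. -/
lemma exp_neg_div_le {a V p : ℝ} (ha : 0 < a) (hV : 0 < V) (hp : 0 < p) :
    Real.exp (-(a / V)) ≤ (p / a) ^ p * V ^ p := by
  have hx : 0 < a / V / p := by positivity
  have h1 : (a / V / p) ^ p ≤ Real.exp (a / V) := by
    calc _ ≤ Real.exp (a / V / p) ^ p :=
          Real.rpow_le_rpow hx.le ((le_add_of_nonneg_right zero_le_one).trans
            (Real.add_one_le_exp _)) hp.le
      _ = _ := by rw [← Real.exp_mul, div_mul_cancel₀ _ hp.ne']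
  rw [Real.exp_neg, ← Real.mul_rpow (by positivity) hV.le]
  calc _ ≤ ((a / V / p) ^ p)⁻¹ := inv_anti₀ (Real.rpow_pos_of_pos hx _) h1
    _ = _ := by rw [← Real.inv_rpow hx.le]; congr 1; field_simp

section Noise

variable {Ω : Type*} {N : ℕ} {y : ℕ → Ω → Fin N}

lemma noiseFiltration_mono (y : ℕ → Ω → Fin N) : Monotone (noiseFiltration y) :=
  fun _ _ hab => biSup_mono fun _ hi => ⟨hi.1, hi.2.trans hab⟩

lemma measurable_noise (y : ℕ → Ω → Fin N) (k : ℕ) :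
    Measurable[noiseFiltration y (k + 1)] (y (k + 1)) :=
  measurable_iff_comap_le.2
    (le_biSup (fun i => MeasurableSpace.comap (y i) inferInstance) (i := k + 1) (by simp))

/-- Predictable martingale differences driven by the noise: `D i ω c` is the value at step `i` if
the next noise variable takes the value `c`. -/
structure IsNoiseDifference (y : ℕ → Ω → Fin N) (D : ℕ → Ω → Fin N → ℝ) (b : ℕ → ℝ) : Prop where
  measurable : ∀ i c, Measurable[noiseFiltration y i] fun ω => D i ω c
  bound : ∀ i ω c, |D i ω c| ≤ b i
  sum_eq_zero : ∀ i ω, ∑ c, D i ω c = 0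

variable {D : ℕ → Ω → Fin N → ℝ} {b : ℕ → ℝ}

lemma measurable_apply_noise {m : MeasurableSpace Ω} {z : Ω → Fin N} (hz : Measurable[m] z)
    {V : Fin N → Ω → ℝ} (hV : ∀ c, Measurable[m] (V c)) :
    Measurable[m] fun ω => V (z ω) ω :=
  (measurable_from_prod_countable_right (f := fun q : Fin N × Ω => V q.1 q.2) hV).comp
    (hz.prodMk measurable_id)

lemma IsNoiseDifference.measurable_sum (hD : IsNoiseDifference y D b) (n k : ℕ) :
    Measurable[noiseFiltration y k] fun ω => ∑ i ∈ Finset.Ico n k, D i ω (y (i + 1) ω) := by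
  refine Finset.measurable_fun_sum _ fun i hi => ?_
  have hik : i + 1 ≤ k := (Finset.mem_Ico.1 hi).2
  refine Measurable.mono ?_ (noiseFiltration_mono y hik) le_rfl
  exact measurable_apply_noise (V := fun c ω => D i ω c) (measurable_noise y i) fun c =>
    (hD.measurable i c).mono (noiseFiltration_mono y (Nat.le_succ i)) le_rfl

lemma IsNoiseDifference.neg (hD : IsNoiseDifference y D b) :
    IsNoiseDifference y (fun i ω c => -D i ω c) b where
  measurable i c := (hD.measurable i c).neg
  bound i ω c := by rw [abs_neg]; exact hD.bound i ω c
  sum_eq_zero i ω := by rw [Finset.sum_neg_distrib, hD.sum_eq_zero, neg_zero]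

open Classical in
/-- The differences stopped once a partial sum started at `n` reaches the level `ε`. -/
def stoppedDifference (y : ℕ → Ω → Fin N) (D : ℕ → Ω → Fin N → ℝ) (n : ℕ) (ε : ℝ)
    (i : ℕ) (ω : Ω) (c : Fin N) : ℝ :=
  if ∀ k ∈ Finset.Icc n i, ∑ l ∈ Finset.Ico n k, D l ω (y (l + 1) ω) < ε then D i ω c else 0

/-- The stopping condition at `i` involves only partial sums up to `i`, so it is `ℱ_i`-measurable
and independent of `c`. -/
lemma IsNoiseDifference.stopped (hD : IsNoiseDifference y D b) (n : ℕ) (ε : ℝ) :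
    IsNoiseDifference y (stoppedDifference y D n ε) b where
  measurable i c := by
    refine Measurable.ite ?_ (hD.measurable i c) measurable_const
    have : {ω | ∀ k ∈ Finset.Icc n i, ∑ l ∈ Finset.Ico n k, D l ω (y (l + 1) ω) < ε}
        = ⋂ k ∈ Finset.Icc n i, {ω | ∑ l ∈ Finset.Ico n k, D l ω (y (l + 1) ω) < ε} := by
      ext; simp
    rw [this]
    refine Finset.measurableSet_biInter _ fun k hk => ?_
    exact ((hD.measurable_sum n k).mono (noiseFiltration_mono y (Finset.mem_Icc.1 hk).2) le_rfl)
      measurableSet_Iio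
  bound i ω c := by
    rw [stoppedDifference]
    split_ifs
    · exact hD.bound i ω c
    · rw [abs_zero]; exact (abs_nonneg _).trans (hD.bound i ω c)
  sum_eq_zero i ω := by
    by_cases h : ∀ k ∈ Finset.Icc n i, ∑ l ∈ Finset.Ico n k, D l ω (y (l + 1) ω) < ε
    · simp only [stoppedDifference, if_pos h, hD.sum_eq_zero]
    · simp only [stoppedDifference, if_neg h, Finset.sum_const_zero]

/-- The stopped sum freezes at the first `k` reaching `ε`, so a bound on the terminal value controls
the running maximum. -/
lemma le_sum_stoppedDifference {n m : ℕ} {ε : ℝ} {ω : Ω}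
    (h : ∃ k ∈ Set.Icc n m, ε ≤ ∑ i ∈ Finset.Ico n k, D i ω (y (i + 1) ω)) :
    ε ≤ ∑ i ∈ Finset.Ico n m, stoppedDifference y D n ε i ω (y (i + 1) ω) := by
  classical
  obtain ⟨⟨h1, h2⟩, h3⟩ := Nat.find_spec h
  set k := Nat.find h
  refine h3.trans (le_of_eq ?_)
  rw [← Finset.sum_Ico_consecutive _ h1 h2, Finset.sum_congr rfl (g := fun i =>
    stoppedDifference y D n ε i ω (y (i + 1) ω)), left_eq_add]
  · refine Finset.sum_eq_zero fun i hi => if_neg fun hall => ?_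
    exact absurd (hall k (Finset.mem_Icc.2 ⟨h1, (Finset.mem_Ico.1 hi).1⟩)) h3.not_gt
  · intro i hi
    refine (if_pos fun l hl => ?_).symm
    rw [Finset.mem_Ico] at hi
    rw [Finset.mem_Icc] at hl
    by_contra hlt
    exact Nat.find_min h (hl.2.trans_lt hi.2) ⟨⟨hl.1, by omega⟩, not_lt.1 hlt⟩

variable [mΩ : MeasurableSpace Ω] {P : Measure Ω}

lemma IsUniformIID.noiseFiltration_le (hy : IsUniformIID P y) (k : ℕ) :
    noiseFiltration y k ≤ mΩ :=
  iSup₂_le fun i hi => (hy.measurable i hi.1).comap_le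

lemma IsUniformIID.indep_noise (hy : IsUniformIID P y) (k : ℕ) :
    Indep (noiseFiltration y k) (MeasurableSpace.comap (y (k + 1)) inferInstance) P := by
  have := indep_iSup_of_disjoint (fun i => (hy.measurable (i + 1) (by omega)).comap_le)
    hy.indep.iIndep (S := Set.Iio k) (T := {k}) (by simp)
  simp only [iSup_singleton] at this
  refine indep_of_indep_of_le_left this ?_
  refine iSup₂_le fun i hi => ?_
  obtain ⟨h1, h2⟩ := hi
  obtain ⟨i, rfl⟩ := Nat.exists_eq_add_of_le' h1
  exact le_biSup (fun i => MeasurableSpace.comap (y (i + 1)) inferInstance)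
    (i := i) (show i < k by omega)

/-- Averaging out the next noise variable. -/
lemma IsUniformIID.lintegral_next (hy : IsUniformIID P y) (k : ℕ) {V : Fin N → Ω → ℝ≥0∞}
    (hV : ∀ c, Measurable[noiseFiltration y k] (V c)) :
    ∫⁻ ω, V (y (k + 1) ω) ω ∂P = (N : ℝ≥0∞)⁻¹ * ∫⁻ ω, ∑ c, V c ω ∂P := by
  have hle := hy.noiseFiltration_le k
  have hVm : ∀ c, Measurable (V c) := fun c => (hV c).mono hle le_rfl
  have hym : Measurable (y (k + 1)) := hy.measurable _ (by omega)
  have hset : ∀ c, MeasurableSet (y (k + 1) ⁻¹' {c}) := fun c => hym (measurableSet_singleton c)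
  -- Splitting by the value of the noise gives products of an `ℱ_k`-measurable factor and an
  -- independent indicator.
  have e : ∀ ω, V (y (k + 1) ω) ω
      = ∑ c, V c ω * (y (k + 1) ⁻¹' {c}).indicator (fun _ => 1) ω := by
    intro ω
    rw [Finset.sum_eq_single (y (k + 1) ω)]
    · simp
    · intro c _ hc
      rw [Set.indicator_of_notMem (by simpa using hc.symm), mul_zero]
    · simp
  simp_rw [e]
  rw [lintegral_finsetSum _ fun c _ => Measurable.fun_mul (hVm c)
    (measurable_const.indicator (hset c)), lintegral_finsetSum _ fun c _ => hVm c, Finset.mul_sum]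
  refine Finset.sum_congr rfl fun c _ => ?_
  rw [lintegral_mul_eq_lintegral_mul_lintegral_of_independent_measurableSpace hle hym.comap_le
    (hy.indep_noise k) (hV c)
    (measurable_const.indicator ⟨{c}, measurableSet_singleton c, rfl⟩),
    lintegral_indicator_const (hset c), one_mul, hy.uniform _ (by omega), mul_comm]

/-- Averaging out the newest noise variable costs a factor `exp(r² b_k² / 2)` by Hoeffding's lemma.
-/
lemma IsNoiseDifference.lintegral_exp_le [IsProbabilityMeasure P] (hD : IsNoiseDifference y D b)
    (hy : IsUniformIID P y) (r : ℝ) {n k : ℕ} (hnk : n ≤ k) :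
    ∫⁻ ω, ENNReal.ofReal (Real.exp (r * ∑ i ∈ Finset.Ico n k, D i ω (y (i + 1) ω))) ∂P ≤
      ENNReal.ofReal (Real.exp (r ^ 2 / 2 * ∑ i ∈ Finset.Ico n k, b i ^ 2)) := by
  induction k, hnk using Nat.le_induction with
  | base => simp
  | succ k hnk ih =>
    -- A probability space is nonempty, so `Fin N` contains a value of `y 1`.
    have hN : (N : ℝ≥0∞) ≠ 0 := by
      obtain ⟨ω⟩ : Nonempty Ω := P.nonempty_of_neZero
      have := (y 1 ω).pos
      exact_mod_cast this.ne'
    set S : Ω → ℝ := fun ω => ∑ i ∈ Finset.Ico n k, D i ω (y (i + 1) ω)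
    have hS : Measurable[noiseFiltration y k] S := hD.measurable_sum n k
    have hV : ∀ c, Measurable[noiseFiltration y k] fun ω =>
        ENNReal.ofReal (Real.exp (r * S ω)) * ENNReal.ofReal (Real.exp (r * D k ω c)) := fun c =>
      ((hS.const_mul r).exp.ennreal_ofReal).mul
        (((hD.measurable k c).const_mul r).exp.ennreal_ofReal)
    have key : ∀ ω, ∑ c, ENNReal.ofReal (Real.exp (r * D k ω c)) ≤
        N * ENNReal.ofReal (Real.exp (r ^ 2 / 2 * b k ^ 2)) := by
      intro ω
      have := sum_exp_le_card_mul_exp (x := fun c => r * D k ω c) (b := |r| * b k)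
        (fun c => by rw [abs_mul]; gcongr; exact hD.bound k ω c)
        (by rw [← Finset.mul_sum, hD.sum_eq_zero, mul_zero])
      rw [← ENNReal.ofReal_sum_of_nonneg fun _ _ => (Real.exp_pos _).le, ← ENNReal.ofReal_natCast N,
        ← ENNReal.ofReal_mul (by positivity)]
      refine ENNReal.ofReal_le_ofReal (this.trans (le_of_eq ?_))
      rw [mul_pow, sq_abs, Fintype.card_fin]
      ring_nf
    calc ∫⁻ ω, ENNReal.ofReal (Real.exp (r * ∑ i ∈ Finset.Ico n (k + 1), D i ω (y (i + 1) ω))) ∂P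
        = ∫⁻ ω, ENNReal.ofReal (Real.exp (r * S ω)) *
            ENNReal.ofReal (Real.exp (r * D k ω (y (k + 1) ω))) ∂P := by
          refine lintegral_congr fun ω => ?_
          rw [Finset.sum_Ico_succ_top hnk, mul_add, Real.exp_add,
            ENNReal.ofReal_mul (Real.exp_pos _).le]
      _ = (N : ℝ≥0∞)⁻¹ * ∫⁻ ω, ∑ c, ENNReal.ofReal (Real.exp (r * S ω)) *
            ENNReal.ofReal (Real.exp (r * D k ω c)) ∂P := hy.lintegral_next k hV
      _ ≤ (N : ℝ≥0∞)⁻¹ * ∫⁻ ω, ENNReal.ofReal (Real.exp (r * S ω)) *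
            (N * ENNReal.ofReal (Real.exp (r ^ 2 / 2 * b k ^ 2))) ∂P := by
          gcongr with ω
          rw [← Finset.mul_sum]
          gcongr
          exact key ω
      _ = (∫⁻ ω, ENNReal.ofReal (Real.exp (r * S ω)) ∂P) *
            ENNReal.ofReal (Real.exp (r ^ 2 / 2 * b k ^ 2)) := by
          rw [lintegral_mul_const' _ _ (by finiteness)]
          calc _ = ((N : ℝ≥0∞)⁻¹ * N) * ((∫⁻ ω, ENNReal.ofReal (Real.exp (r * S ω)) ∂P) *
                ENNReal.ofReal (Real.exp (r ^ 2 / 2 * b k ^ 2))) := by ring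
            _ = _ := by rw [ENNReal.inv_mul_cancel hN (by finiteness), one_mul]
      _ ≤ ENNReal.ofReal (Real.exp (r ^ 2 / 2 * ∑ i ∈ Finset.Ico n k, b i ^ 2)) *
            ENNReal.ofReal (Real.exp (r ^ 2 / 2 * b k ^ 2)) := by gcongr
      _ = _ := by
          rw [← ENNReal.ofReal_mul (Real.exp_pos _).le, ← Real.exp_add, ← mul_add,
            Finset.sum_Ico_succ_top hnk]

/-- A maximal inequality: Markov's inequality for the exponential of the stopped sum. -/
lemma IsNoiseDifference.measure_exists_le [IsProbabilityMeasure P] (hD : IsNoiseDifference y D b)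
    (hy : IsUniformIID P y) {r : ℝ} (hr : 0 ≤ r) (ε : ℝ) {n m : ℕ} (hnm : n ≤ m) :
    P {ω | ∃ k ∈ Set.Icc n m, ε ≤ ∑ i ∈ Finset.Ico n k, D i ω (y (i + 1) ω)} ≤
      ENNReal.ofReal (Real.exp (r ^ 2 / 2 * ∑ i ∈ Finset.Ico n m, b i ^ 2 - r * ε)) := by
  have hD' := hD.stopped n ε
  have hmeas := (hD'.measurable_sum n m).mono (hy.noiseFiltration_le m) le_rfl
  calc _ ≤ P {ω | ENNReal.ofReal (Real.exp (r * ε)) ≤ ENNReal.ofReal (Real.exp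
            (r * ∑ i ∈ Finset.Ico n m, stoppedDifference y D n ε i ω (y (i + 1) ω)))} := by
        refine measure_mono fun ω hω => ENNReal.ofReal_le_ofReal (Real.exp_le_exp.2 ?_)
        exact mul_le_mul_of_nonneg_left (le_sum_stoppedDifference hω) hr
    _ ≤ _ := meas_ge_le_lintegral_div (hmeas.const_mul r).exp.ennreal_ofReal.aemeasurable
        (by simp [Real.exp_pos]) ENNReal.ofReal_ne_top
    _ ≤ _ := ENNReal.div_le_div_right (hD'.lintegral_exp_le hy r hnm) _
    _ = _ := by rw [← ENNReal.ofReal_div_of_pos (Real.exp_pos _), ← Real.exp_sub]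

lemma IsNoiseDifference.exists_measure_le [IsProbabilityMeasure P] {h : ℕ → ℝ} {B p ε : ℝ}
    (hD : IsNoiseDifference y D fun i => B * h (i + 1)) (hy : IsUniformIID P y)
    (hpos : ∀ k, 0 < h (k + 1)) (hB : 0 < B) (hp : 0 < p) (hε : 0 < ε) :
    ∃ C, 0 ≤ C ∧ ∀ n m,
      P {ω | ∃ k ∈ Set.Icc n m, ε ≤ ∑ i ∈ Finset.Ico n k, D i ω (y (i + 1) ω)} ≤
        ENNReal.ofReal (C * (∑ i ∈ Finset.Ico n m, h (i + 1) ^ 2) ^ p) := by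
  refine ⟨(p / (ε ^ 2 / (2 * B ^ 2))) ^ p, by positivity, fun n m => ?_⟩
  rcases le_or_gt m n with hmn | hnm
  · have : {ω | ∃ k ∈ Set.Icc n m, ε ≤ ∑ i ∈ Finset.Ico n k, D i ω (y (i + 1) ω)} = ∅ := by
      refine Set.eq_empty_of_forall_notMem ?_
      rintro ω ⟨k, ⟨_, hk⟩, h⟩
      rw [Finset.Ico_eq_empty (by omega), Finset.sum_empty] at h
      exact h.not_gt hε
    rw [this, measure_empty]
    exact zero_le
  · set V := ∑ i ∈ Finset.Ico n m, h (i + 1) ^ 2 with hVdef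
    have hV : 0 < V := Finset.sum_pos (fun i _ => pow_pos (hpos i) 2) ⟨n, by simp [hnm]⟩
    -- This `r` minimizes the exponent `r² B² V / 2 - r ε`, with minimum `-ε² / (2 B² V)`.
    refine (hD.measure_exists_le hy (r := ε / (B ^ 2 * V)) (by positivity) ε hnm.le).trans ?_
    refine ENNReal.ofReal_le_ofReal ?_
    refine le_trans (le_of_eq ?_) (exp_neg_div_le (a := ε ^ 2 / (2 * B ^ 2)) (by positivity) hV hp)
    congr 1
    simp only [mul_pow]
    rw [← Finset.mul_sum, ← hVdef]
    field_simp
    ring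

/-- Borel–Cantelli over the windows, applied to `D` and `-D` for the two signs. -/
lemma IsNoiseDifference.ae_eventually_abs_lt [IsProbabilityMeasure P] {h : ℕ → ℝ} {B p ε : ℝ}
    (hD : IsNoiseDifference y D fun i => B * h (i + 1)) (hy : IsUniformIID P y)
    (hh : Admissible h) (hB : 0 < B) (hp : 1 ≤ p)
    (hs : Summable fun k : ℕ => h (k + 1) ^ (1 + p)) (hε : 0 < ε) (S : ℕ) :
    ∀ᵐ ω ∂P, ∀ᶠ l : ℕ in atTop,
      ∀ k ∈ Set.Icc (hitIndex h (l * S)) (hitIndex h ((l + 2 : ℕ) * S)),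
        |∑ i ∈ Finset.Ico (hitIndex h (l * S)) k, D i ω (y (i + 1) ω)| < ε := by
  have upper : ∀ {D' : ℕ → Ω → Fin N → ℝ},
      IsNoiseDifference y D' (fun i => B * h (i + 1)) → ∀ᵐ ω ∂P, ∀ᶠ l : ℕ in atTop,
        ω ∉ {ω | ∃ k ∈ Set.Icc (hitIndex h (l * S)) (hitIndex h ((l + 2 : ℕ) * S)),
          ε ≤ ∑ i ∈ Finset.Ico (hitIndex h (l * S)) k, D' i ω (y (i + 1) ω)} := by
    intro D' hD'
    obtain ⟨C, hC0, hC⟩ := hD'.exists_measure_le hy (fun k => hh.pos _ (by omega)) hB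
      (zero_lt_one.trans_le hp) hε
    refine ae_eventually_notMem (ne_top_of_le_ne_top ?_ (ENNReal.tsum_le_tsum fun l => hC _ _))
    exact ((hh.summable_sum_sq_rpow hp hs S).mul_left C).tsum_ofReal_ne_top
  filter_upwards [upper hD, upper hD.neg] with ω h1 h2
  filter_upwards [h1, h2] with l h1 h2 k hk
  refine abs_lt.2 ⟨?_, ?_⟩
  · have := not_le.1 fun h => h2 ⟨k, hk, h⟩
    rw [Finset.sum_neg_distrib] at this
    linarith
  · exact not_le.1 fun h => h1 ⟨k, hk, h⟩

end Noise

/-! ### The gradient noise -/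

section Gradient

variable {n N : ℕ}

lemma continuous_gradient {f : Vec n → ℝ} (hf : ContDiff ℝ 1 f) : Continuous (gradient f) :=
  (InnerProductSpace.toDual ℝ (Vec n)).symm.continuous.comp (hf.continuous_fderiv one_ne_zero)

lemma ObjectiveAssumption.gradient_eq {Ψ : Vec n → ℝ} {Ψi : Fin N → Vec n → ℝ}
    (hΨ : ObjectiveAssumption Ψ Ψi) (q : Vec n) :
    gradient Ψ q = (1 / (N : ℝ)) • ∑ c, gradient (Ψi c) q := by
  refine HasGradientAt.gradient (hasGradientAt_iff_hasFDerivAt.2 ?_)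
  have h1 : ∀ c, HasFDerivAt (Ψi c)
      (InnerProductSpace.toDual ℝ (Vec n) (gradient (Ψi c) q)) q := fun c =>
    (((hΨ.summand_contDiff c).differentiable one_ne_zero).differentiableAt
      |>.hasGradientAt).hasFDerivAt
  have h2 := (HasFDerivAt.fun_sum (u := Finset.univ) fun c _ => h1 c).const_mul (1 / (N : ℝ))
  rw [map_smul, map_sum]
  rwa [funext hΨ.finite_sum]

/-- The error of the stochastic gradient at `q` for the sample `c`, truncated to `‖q‖ ≤ R`. -/
def truncatedNoise (Ψ : Vec n → ℝ) (Ψi : Fin N → Vec n → ℝ) (R : ℝ) (c : Fin N) : Vec n → Vec n :=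
  (Metric.closedBall 0 R).indicator fun q => gradient (Ψi c) q - gradient Ψ q

variable {Ψ : Vec n → ℝ} {Ψi : Fin N → Vec n → ℝ}

lemma ObjectiveAssumption.measurable_truncatedNoise (hΨ : ObjectiveAssumption Ψ Ψi) (R : ℝ)
    (c : Fin N) : Measurable (truncatedNoise Ψ Ψi R c) :=
  ((continuous_gradient (hΨ.summand_contDiff c)).sub
    (continuous_gradient hΨ.contDiff)).measurable.indicator measurableSet_closedBall

/-- The truncation depends on `q` alone, not on the sample, so centring survives. -/
lemma ObjectiveAssumption.sum_truncatedNoise (hΨ : ObjectiveAssumption Ψ Ψi) (R : ℝ)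
    (q : Vec n) : ∑ c, truncatedNoise Ψ Ψi R c q = 0 := by
  by_cases hq : q ∈ Metric.closedBall 0 R
  · have hN : (N : ℝ) ≠ 0 := by have := hΨ.one_le; positivity
    simp only [truncatedNoise, Set.indicator_of_mem hq, Finset.sum_sub_distrib, Finset.sum_const,
      Finset.card_univ, Fintype.card_fin, hΨ.gradient_eq q]
    rw [← Nat.cast_smul_eq_nsmul ℝ, smul_smul, mul_one_div_cancel hN, one_smul, sub_self]
  · simp only [truncatedNoise, Set.indicator_of_notMem hq, Finset.sum_const_zero]

lemma ObjectiveAssumption.exists_norm_truncatedNoise_le (hΨ : ObjectiveAssumption Ψ Ψi) (R : ℝ) :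
    ∃ B, 0 < B ∧ ∀ c q, ‖truncatedNoise Ψ Ψi R c q‖ ≤ B := by
  have h : ∀ c, ∃ B, ∀ q ∈ Metric.closedBall (0 : Vec n) R,
      ‖gradient (Ψi c) q - gradient Ψ q‖ ≤ B := fun c =>
    (isCompact_closedBall (0 : Vec n) R).exists_bound_of_continuousOn
      ((continuous_gradient (hΨ.summand_contDiff c)).sub
        (continuous_gradient hΨ.contDiff)).continuousOn
  choose B hB using h
  have hB1 : 0 < ∑ c, |B c| + 1 := by positivity
  refine ⟨_, hB1, fun c q => ?_⟩
  by_cases hq : q ∈ Metric.closedBall 0 R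
  · rw [truncatedNoise, Set.indicator_of_mem hq]
    calc _ ≤ B c := hB c q hq
      _ ≤ |B c| := le_abs_self _
      _ ≤ ∑ c, |B c| := Finset.single_le_sum (fun c _ => abs_nonneg (B c)) (Finset.mem_univ c)
      _ ≤ _ := by linarith
  · rw [truncatedNoise, Set.indicator_of_notMem hq, norm_zero]
    exact hB1.le

lemma norm_le_sum_abs (v : Vec n) : ‖v‖ ≤ ∑ j, |v j| := by
  conv_lhs => rw [← (EuclideanSpace.basisFun (Fin n) ℝ).sum_repr v]
  refine (norm_sum_le _ _).trans (Finset.sum_le_sum fun j _ => ?_)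
  simp [norm_smul]

end Gradient

/-! ### The position component of a solution -/

section Position

variable {n N : ℕ} {Ψi : Fin N → Vec n → ℝ} {κ T : ℝ} {hs hf : ℕ → ℝ}

open Classical in
/-- The `q`-component of a hybrid sequence at time `k`, at an unspecified `j` in the domain; it is
zero if there is no such `j`. -/
def position (φ : HybridSequence (State n)) (k : ℕ) : Vec n :=
  if h : ∃ j, (k, j) ∈ φ.dom then (φ.val k h.choose).1.1 else 0

lemma SatisfiesSimulator.val_eq_of_le {z : ℕ → Fin N} {φ : HybridSequence (State n)}
    (hφ : SatisfiesSimulator Ψi κ T hs hf z φ) {k j j' : ℕ} (hj : (k, j) ∈ φ.dom)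
    (hj' : (k, j') ∈ φ.dom) (hjj' : j ≤ j') : (φ.val k j').1.1 = (φ.val k j).1.1 := by
  induction j', hjj' using Nat.le_induction with
  | base => rfl
  | succ i hi ih =>
    have hmem : (k, i) ∈ φ.dom := φ.mem_dom_of_mem_of_mem hj hj' hi (Nat.le_succ i)
    rw [(hφ.jump k i hmem hj').2.1, ← ih hmem, jumpHB]

lemma SatisfiesSimulator.position_eq {z : ℕ → Fin N} {φ : HybridSequence (State n)}
    (hφ : SatisfiesSimulator Ψi κ T hs hf z φ) {k j : ℕ} (hj : (k, j) ∈ φ.dom) :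
    position φ k = (φ.val k j).1.1 := by
  have h : ∃ j, (k, j) ∈ φ.dom := ⟨j, hj⟩
  rw [position, dif_pos h]
  rcases le_total j h.choose with hle | hle
  · exact hφ.val_eq_of_le hj h.choose_spec hle
  · exact (hφ.val_eq_of_le h.choose_spec hj hle).symm

/-- Adaptedness only says which open sets the graph over `k` meets. Since `q` is constant over `k`,
meeting `{q ∈ U}` is the same as the position lying in `U`; the default value `0` is treated
separately. -/
lemma IsSimulatorSolution.measurable_position {Ω : Type*} {y : ℕ → Ω → Fin N}
    {X : Ω → HybridSequence (State n)} (hX : IsSimulatorSolution Ψi κ T hs hf y X) (k : ℕ) :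
    Measurable[noiseFiltration y k] fun ω => position (X ω) k := by
  refine @measurable_of_isOpen _ _ _ _ _ (noiseFiltration y k) _ fun U hU => ?_
  have hne : MeasurableSet[noiseFiltration y k] {ω | ∃ j, (k, j) ∈ (X ω).dom} := by
    convert hX.adapted k Set.univ isOpen_univ using 1
    ext ω
    constructor
    · rintro ⟨j, hj⟩
      exact ⟨(k, j, (X ω).val k j), ⟨⟨hj, rfl⟩, rfl⟩, trivial⟩
    · rintro ⟨⟨a, j, x⟩, ⟨⟨hj, -⟩, rfl⟩, -⟩
      exact ⟨j, hj⟩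
  have hhit := hX.adapted k {z | z.2.2.1.1 ∈ U} (hU.preimage (by fun_prop))
  have : (fun ω => position (X ω) k) ⁻¹' U =
      {ω | ((X ω).graph ∩ {z | z.1 = k} ∩ {z | z.2.2.1.1 ∈ U}).Nonempty} ∪
        ({ω | ∃ j, (k, j) ∈ (X ω).dom}ᶜ ∩ {_ω | (0 : Vec n) ∈ U}) := by
    ext ω
    by_cases h : ∃ j, (k, j) ∈ (X ω).dom
    · obtain ⟨j, hj⟩ := h
      have hnot : ω ∉ {ω | ∃ j, (k, j) ∈ (X ω).dom}ᶜ := fun h => h ⟨j, hj⟩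
      simp only [Set.mem_preimage, Set.mem_union, Set.mem_inter_iff, hnot, false_and, or_false]
      constructor
      · intro hU
        rw [(hX.satisfies ω).position_eq hj] at hU
        exact ⟨(k, j, (X ω).val k j), ⟨⟨hj, rfl⟩, rfl⟩, hU⟩
      · rintro ⟨⟨a, i, x⟩, ⟨⟨hi, hx⟩, rfl⟩, hU⟩
        rw [(hX.satisfies ω).position_eq hi]
        exact (congrArg (fun x : State n => x.1.1) hx) ▸ hU
    · have hempty : ¬ ((X ω).graph ∩ {z | z.1 = k} ∩ {z | z.2.2.1.1 ∈ U}).Nonempty := by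
        rintro ⟨⟨a, i, x⟩, ⟨⟨hi, -⟩, rfl⟩, -⟩
        exact h ⟨i, hi⟩
      have hmem : ω ∈ {ω | ∃ j, (k, j) ∈ (X ω).dom}ᶜ := h
      simp only [Set.mem_preimage, position, dif_neg h, Set.mem_union, Set.mem_ofPred_eq, hempty,
        Set.mem_inter_iff, hmem, true_and, false_or]
  rw [this]
  exact hhit.union (hne.compl.inter (MeasurableSet.const _))

end Position

/-! ### Asymptotic simulation -/

section Main

variable {Ω : Type*} {n N : ℕ} {Ψ : Vec n → ℝ}
  {Ψi : Fin N → Vec n → ℝ} {κ T : ℝ} {hs hf : ℕ → ℝ} {y : ℕ → Ω → Fin N}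
  {X : Ω → HybridSequence (State n)}

lemma IsSimulatorSolution.isNoiseDifference (hX : IsSimulatorSolution Ψi κ T hs hf y X)
    (hΨ : ObjectiveAssumption Ψ Ψi) (hpos : ∀ k, 0 < hf (k + 1)) {R B : ℝ}
    (hB : ∀ c q, ‖truncatedNoise Ψ Ψi R c q‖ ≤ B) (j : Fin n) :
    IsNoiseDifference y (fun i ω c => hf (i + 1) * truncatedNoise Ψ Ψi R c (position (X ω) i) j)
      (fun i => B * hf (i + 1)) where
  measurable i c := by
    have h : Measurable fun q => truncatedNoise Ψ Ψi R c q j :=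
      (EuclideanSpace.proj (𝕜 := ℝ) j).continuous.measurable.comp
        (hΨ.measurable_truncatedNoise R c)
    exact (h.comp (hX.measurable_position i)).const_mul _
  bound i ω c := by
    rw [abs_mul, abs_of_pos (hpos i), mul_comm]
    exact mul_le_mul_of_nonneg_right ((PiLp.norm_apply_le _ j).trans (hB _ _)) (hpos i).le
  sum_eq_zero i ω := by
    have := congrArg (fun v : Vec n => v j) (hΨ.sum_truncatedNoise R (position (X ω) i))
    simp only [WithLp.ofLp_sum, Finset.sum_apply, PiLp.zero_apply] at this
    rw [← Finset.mul_sum, this, mul_zero]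

/-- One null set serves all `R`, `fhat` and `f`: closeness depends only on the differences `fhat (i
+ 1) - f i`, and the remaining parameters are countable. -/
lemma IsSimulatorSolution.ae_asymptoticallyClose [MeasurableSpace Ω] {P : Measure Ω}
    [IsProbabilityMeasure P]
    (hX : IsSimulatorSolution Ψi κ T hs hf y X) (hΨ : ObjectiveAssumption Ψ Ψi)
    (hsteps : StepAssumption hs hf) (hy : IsUniformIID P y) :
    ∀ᵐ ω ∂P, ∀ R : ℕ, ∀ fhat f : ℕ → Vec n,
      (∀ i, fhat (i + 1) - f i = truncatedNoise Ψ Ψi R (y (i + 1) ω) (position (X ω) i)) →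
        AsymptoticallyClose hf fhat f := by
  obtain ⟨p, hp, hsum⟩ := hsteps.summable
  have hh := hsteps.admissible.fast
  have hpos : ∀ k, 0 < hf (k + 1) := fun k => hh.pos _ (by omega)
  have key : ∀ᵐ ω ∂P, ∀ R S m : ℕ, ∀ j : Fin n, ∀ᶠ l : ℕ in atTop,
      ∀ k ∈ Set.Icc (hitIndex hf (l * S)) (hitIndex hf ((l + 2 : ℕ) * S)),
        |∑ i ∈ Finset.Ico (hitIndex hf (l * S)) k,
          hf (i + 1) * truncatedNoise Ψ Ψi R (y (i + 1) ω) (position (X ω) i) j|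
            < 1 / ((m : ℝ) + 1) := by
    simp only [ae_all_iff]
    intro R S m j
    obtain ⟨B, hB0, hB⟩ := hΨ.exists_norm_truncatedNoise_le R
    exact (hX.isNoiseDifference hΨ hpos hB j).ae_eventually_abs_lt hy hh hB0 hp hsum
      Nat.one_div_pos_of_nat S
  filter_upwards [key] with ω hω R fhat f hf'
  refine hh.asymptoticallyClose fun S _ ε hε => ?_
  -- An allowance per coordinate; dividing by `n + 1` also covers `n = 0`.
  obtain ⟨m, hm⟩ := exists_nat_one_div_lt (show 0 < ε / (n + 1) by positivity)
  filter_upwards [eventually_all.2 fun j => hω R S m j] with l hl k hk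
  simp only [hf']
  calc _ ≤ _ := norm_le_sum_abs _
    _ ≤ ∑ _j : Fin n, ε / (n + 1) := by
      refine Finset.sum_le_sum fun j _ => le_trans (le_of_eq ?_) ((hl j k hk).trans hm).le
      simp only [WithLp.ofLp_sum, Finset.sum_apply, PiLp.smul_apply, smul_eq_mul]
    _ ≤ ε := by
      rw [Finset.sum_const, Finset.card_univ, Fintype.card_fin, nsmul_eq_mul, mul_div_assoc',
        div_le_iff₀ (by positivity)]
      nlinarith

/-- The flow map of the limiting system with unit timescale separation. -/
def flowMap (Ψ : Vec n → ℝ) (κ T : ℝ) (x : State n) : State n :=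
  (flowHB κ T x.1 x.2, -x.2 + gradient Ψ x.1.1)

lemma ObjectiveAssumption.continuous_flowMap (hΨ : ObjectiveAssumption Ψ Ψi) :
    Continuous (flowMap Ψ κ T) := by
  have := continuous_gradient hΨ.contDiff
  unfold flowMap flowHB
  fun_prop

lemma isClosed_flowSet : IsClosed (flowSet n T) := by
  have h1 : Continuous fun x : State n => (inner ℝ x.2 x.1.2.1 : ℝ) := by fun_prop
  have h2 : Continuous fun x : State n => x.1.2.2 := by fun_prop
  exact ((isClosed_le h1 continuous_const).inter (isClosed_le continuous_const h2)).union
    (isClosed_le h2 continuous_const)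

lemma isClosed_jumpSet : IsClosed (jumpSet n T) := by
  have h1 : Continuous fun x : State n => (inner ℝ x.2 x.1.2.1 : ℝ) := by fun_prop
  have h2 : Continuous fun x : State n => x.1.2.2 := by fun_prop
  exact (isClosed_le continuous_const h1).inter (isClosed_le continuous_const h2)

lemma graphFC_system2HB : (system2HB Ψ κ T 1).graphFC =
    {z | z.1 ∈ flowSet n T ∧ z.2 = flowMap Ψ κ T z.1} := by
  ext ⟨x, v⟩
  simp [HybridInclusion.graphFC, system2HB, twoTimescaleSystem, flowMap, Prod.ext_iff]

lemma graphGD_system2HB : (system2HB Ψ κ T 1).graphGD =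
    {z | z.1 ∈ jumpSet n T ∧ z.2 = (jumpHB z.1.1, z.1.2)} := by
  ext ⟨x, v⟩
  simp [HybridInclusion.graphGD, system2HB, twoTimescaleSystem]

lemma SatisfiesSimulator.outerLimit_jump_subset {z : ℕ → Fin N} {φ : HybridSequence (State n)}
    (hφ : SatisfiesSimulator Ψi κ T hs hf z φ) (hJ : φ.CompleteJ) :
    outerLimit (fun j => (φ.val (φ.kbar j) j, φ.val (φ.kbar j) (j + 1))) ⊆
      (system2HB Ψ κ T 1).graphGD := by
  rw [graphGD_system2HB]
  refine outerLimit_subset_of_isClosed ?_ fun j => ?_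
  · refine (isClosed_jumpSet.preimage continuous_fst).inter (isClosed_eq continuous_snd ?_)
    unfold jumpHB
    fun_prop
  · obtain ⟨h1, h2⟩ := φ.mem_dom_sInf_snd (hJ.exists_mem (j + 1))
    obtain ⟨hD, hs, hf⟩ := hφ.jump _ _ h2 h1
    exact ⟨hD, Prod.ext hs hf⟩

lemma AsymptoticallyClose.of_forall_eq {E : Type*} [NormedAddCommGroup E] [NormedSpace ℝ E]
    {h : ℕ → ℝ} {fhat f : ℕ → E} (H : ∀ i, fhat (i + 1) = f i) : AsymptoticallyClose h fhat f := by
  intro S _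
  refine tendsto_const_nhds.congr fun m => le_antisymm (Real.sSup_nonneg ?_) (Real.sSup_le ?_ le_rfl)
  · rintro _ ⟨k, -, rfl⟩
    exact norm_nonneg _
  · rintro _ ⟨k, -, rfl⟩
    simp [H]

lemma SatisfiesSimulator.isTwoTimescaleAsymptoticSimulation {z : ℕ → Fin N}
    {φ : HybridSequence (State n)} (hφ : SatisfiesSimulator Ψi κ T hs hf z φ)
    (hΨ : ObjectiveAssumption Ψ Ψi) (hadm : TwoTimescaleAdmissible hs hf)
    (hb : φ.Bounded) (hc : φ.Complete)
    (H : ∀ R : ℕ, ∀ fhat f : ℕ → Vec n,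
      (∀ i, fhat (i + 1) - f i = truncatedNoise Ψ Ψi R (z (i + 1)) (position φ i)) →
        AsymptoticallyClose hf fhat f) :
    IsTwoTimescaleAsymptoticSimulation (system2HB Ψ κ T 1) φ hs hf where
  bounded := hb
  complete := hc
  admissible := hadm
  jump := hφ.outerLimit_jump_subset
  flow hK := by
    have hdom := fun k => φ.mem_dom_sInf_fst (hK.exists_mem (k + 1))
    have hflow := fun k => hφ.flow k (φ.jbar k) (hdom k).2 (hdom k).1
    have hcont : Continuous (flowMap Ψ κ T) := hΨ.continuous_flowMap
    refine ⟨fun k => flowMap Ψ κ T (φ.val k (φ.jbar k)), ?_, ?_, ?_, ?_⟩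
    · refine (hb.isCompact_closure.image hcont).isBounded.subset ?_
      rintro _ ⟨k, rfl⟩
      exact Set.mem_image_of_mem _ (subset_closure ⟨k, _, (hdom k).2, rfl⟩)
    · rw [graphFC_system2HB]
      refine outerLimit_subset_of_isClosed ?_ fun k => ⟨(hflow k).1, rfl⟩
      exact (isClosed_flowSet.preimage continuous_fst).inter
        (isClosed_eq continuous_snd (hcont.comp continuous_fst))
    · exact .of_forall_eq fun i => (hflow i).2.1
    -- On a ball containing the whole path the truncation is inactive. The `-ξ` terms cancel,
    -- leaving exactly the gradient error.
    · obtain ⟨R, hR⟩ := hb.exists_norm_le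
      obtain ⟨R', hR'⟩ := exists_nat_ge R
      refine H R' _ _ fun i => ?_
      have hpos := hφ.position_eq (hdom i).2
      have hmem : position φ i ∈ Metric.closedBall (0 : Vec n) R' := by
        rw [mem_closedBall_zero_iff, hpos]
        exact ((norm_fst_le _).trans (norm_fst_le _)).trans
          ((hR _ ⟨i, _, (hdom i).2, rfl⟩).trans hR')
      rw [truncatedNoise, Set.indicator_of_mem hmem, hpos]
      change (hf (i + 1))⁻¹ • ((φ.val (i + 1) (φ.jbar i)).2 - (φ.val i (φ.jbar i)).2) -
        (-(φ.val i (φ.jbar i)).2 + gradient Ψ (φ.val i (φ.jbar i)).1.1) = _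
      rw [(hflow i).2.2]
      abel

end Main

end TTSA

end

theorem mainTheorem5 {Ω : Type*} [MeasurableSpace Ω] (P : MeasureTheory.Measure Ω)
    [MeasureTheory.IsProbabilityMeasure P] {n N : ℕ}
    (Ψ : TTSA.Vec n → ℝ) (Ψi : Fin N → TTSA.Vec n → ℝ)
    (hΨ : TTSA.ObjectiveAssumption Ψ Ψi)
    (κ T : ℝ) (hκ : 0 < κ) (hT : 0 < T)
    (hs hf : ℕ → ℝ) (hsteps : TTSA.StepAssumption hs hf)
    (y : ℕ → Ω → Fin N) (hy : TTSA.IsUniformIID P y)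
    (X : Ω → TTSA.HybridSequence (TTSA.State n))
    (hX : TTSA.IsSimulatorSolution Ψi κ T hs hf y X)
    (Ωhat : Set Ω)
    (hΩhat : ∀ᵐ ω ∂P, ω ∈ Ωhat → (X ω).Bounded ∧ (X ω).Complete) :
    ∀ᵐ ω ∂P, ω ∈ Ωhat →
      TTSA.IsTwoTimescaleAsymptoticSimulation (TTSA.system2HB Ψ κ T 1) (X ω) hs hf := by
  filter_upwards [hΩhat, hX.ae_asymptoticallyClose hΨ hsteps hy] with ω hω H hmem
  exact (hX.satisfies ω).isTwoTimescaleAsymptoticSimulation hΨ hsteps.admissible (hω hmem).1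
    (hω hmem).2 H
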